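/- Let $I=[-1,1]$. For a real-valued $\psi\in C^1(I)$ and real $\lambda$ put \[ m(\lambda)=m_\psi(\lambda):=\mathrm{p.v.}\int_I e^{i\lambda\psi(t)}\,\frac{dt}{t} =\lim_{\varepsilon\to0^+}\int_{\varepsilon\le|t|\le1}e^{i\lambda\psi(t)}\,\frac{dt}{t}. \] For $s\ge1$, the Gevrey class $G^s(I)$ consists of the functions $\psi\in C^\infty(I)$ for which there is a constant $K>0$ with $\sup_{t\in I}|\psi^{(n)}(t)|\le K^{n+1}(n!)^s$ for all integers $n\ge0$. Let $s>1$. (i) If $\psi\in G^s(I)$ is real-valued, then the limit defining $m(\lambda)$ exists for every $\lambda\in\mathbb R$, and $m(\lambda)=O(\log\log\lambda)$ as $\lambda\to\infty$, with an implicit constant independent of $\lambda$ (it may depend on $\psi$ and $s$). (ii) This bound is sharp: the function \[ \psi(t)=\begin{cases}e^{-t^{-1/(s-1)}},&t>0,\\ 0,&t\le0,\end{cases} \] belongs to $G^s(I)$, and along the sequence $\lambda_n=2\pi n\to\infty$ there are constants $0<c\le C$ with \[ c\,\log\log\lambda_n\le|m(\lambda_n)|\le C\,\log\log\lambda_n\qquad\text{for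 all sufficiently large } n. \] -/

import Mathlib

open scoped ContDiff Nat

noncomputable section

namespace SteinWainger

/-- The Gevrey class `G^s([-1,1])` of real-valued functions: smooth on `[-1,1]` (one-sided
derivatives at the endpoints) with `|ψ⁽ⁿ⁾(t)| ≤ K^(n+1) (n!)^s` on `[-1,1]` for all `n`.
Only the values of `ψ` on `[-1,1]` matter. -/
def Gevrey (s : ℝ) (ψ : ℝ → ℝ) : Prop :=
  ContDiffOn ℝ ∞ ψ (Set.Icc (-1) 1) ∧
    ∃ K : ℝ, 0 < K ∧ ∀ n : ℕ, ∀ t ∈ Set.Icc (-1 : ℝ) 1,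
      |iteratedDerivWithin n ψ (Set.Icc (-1) 1) t| ≤ K ^ (n + 1) * (n ! : ℝ) ^ s

/-- The truncated integral `∫_{ε ≤ |t| ≤ 1} e^{iλψ(t)} dt/t`, for `0 < ε < 1`. -/
def truncated (ψ : ℝ → ℝ) (lam ε : ℝ) : ℂ :=
  (∫ t in (-1 : ℝ)..(-ε), Complex.exp (Complex.I * lam * ψ t) / t) +
    ∫ t in ε..(1 : ℝ), Complex.exp (Complex.I * lam * ψ t) / t

/-- `m(λ) = p.v. ∫_{[-1,1]} e^{iλψ(t)} dt/t`, the limit of the truncated integrals as `ε → 0+`. -/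
def m (ψ : ℝ → ℝ) (lam : ℝ) : ℂ :=
  Filter.limUnder (nhdsWithin (0 : ℝ) (Set.Ioi 0)) (truncated ψ lam)

/-- `ψ(t) = exp(-t^{-1/(s-1)})` for `t > 0`, and `0` for `t ≤ 0`. -/
def flatPhase (s t : ℝ) : ℝ :=
  if 0 < t then Real.exp (-(t ^ (-(1 / (s - 1))))) else 0

end SteinWainger

end

namespace SteinWainger

open Set Filter Topology MeasureTheory

/-! After folding `t < 0` onto `t > 0`, the truncated integral is the difference of two one-sided
integrals with phases `ψ(t)` and `ψ(-t)`, and it is split at some `δ`. If the derivatives of orders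
`1, …, n` vanish at `0`, the two phases differ by `O(t^(n+1))`, so the part below `δ` costs at most
`2 M λ δ^(n+1)`, where `M` bounds the derivative of order `n+1` (`norm_m_le`).

Above `δ` there are two cases. If some derivative at `0` is nonzero, integration by parts with `δ =
λ^(-1/(n+1))` gives a bounded `m`. If all vanish, `n` is free: with `n+1 ≈ log λ` and `δ ≈ (log
λ)^(-s)` the Gevrey bound keeps the inner part bounded, while the outer part is trivially at most `2
log(1/δ)`, which is `O(log log λ)`.

For the flat phase the left half-line gives exactly `log(1/ε)`. The right one gives at most
`log(δ/ε) + O(1)`, where `λψ(δ) = 1`, because the phase oscillates fast beyond `δ`. What survives is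
`log(1/δ) = (s-1) log log λ` up to `O(1)`. Membership in the Gevrey class follows from Cauchy
estimates for `exp(-z^(-a))`, `a = 1/(s-1)`, on discs of radius `ct`. -/

/-! ### One-sided integrals and the principal value. -/

/-- The one-sided oscillatory integral `∫_α^β e^{iλf(t)} dt/t`. -/
noncomputable def oscInt (f : ℝ → ℝ) (lam α β : ℝ) : ℂ :=
  ∫ t in α..β, Complex.exp (Complex.I * lam * f t) / t

lemma norm_exp_phase (lam x : ℝ) : ‖Complex.exp (Complex.I * lam * x)‖ = 1 := by
  rw [Complex.norm_exp]; simp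

lemma norm_exp_phase_sub_le (lam x y : ℝ) :
    ‖Complex.exp (Complex.I * lam * x) - Complex.exp (Complex.I * lam * y)‖ ≤
      |lam| * |x - y| := by
  have h : Complex.exp (Complex.I * lam * x) - Complex.exp (Complex.I * lam * y) =
      Complex.exp (Complex.I * lam * y) *
        (Complex.exp (Complex.I * ((lam * (x - y) : ℝ) : ℂ)) - 1) := by
    rw [mul_sub, ← Complex.exp_add]
    push_cast
    ring_nf
  rw [h, norm_mul, norm_exp_phase, one_mul, ← abs_mul]
  exact Real.norm_exp_I_mul_ofReal_sub_one_le

lemma continuousOn_integrand {f : ℝ → ℝ} {s : Set ℝ} (hf : ContinuousOn f s)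
    (hs : ∀ t ∈ s, t ≠ 0) (lam : ℝ) :
    ContinuousOn (fun t : ℝ => Complex.exp (Complex.I * lam * f t) / t) s := by
  have hf' : ContinuousOn (fun t => (f t : ℂ)) s := Complex.continuous_ofReal.comp_continuousOn hf
  refine ContinuousOn.div ?_ Complex.continuous_ofReal.continuousOn
    fun t ht => by exact_mod_cast hs t ht
  exact Complex.continuous_exp.comp_continuousOn (continuousOn_const.mul hf')

lemma intervalIntegrable_integrand {f : ℝ → ℝ} (hf : ContinuousOn f (Icc 0 1)) (lam : ℝ)
    {α β : ℝ} (hα : 0 < α) (hαβ : α ≤ β) (hβ : β ≤ 1) :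
    IntervalIntegrable (fun t : ℝ => Complex.exp (Complex.I * lam * f t) / t) volume α β := by
  apply ContinuousOn.intervalIntegrable
  rw [uIcc_of_le hαβ]
  exact continuousOn_integrand (hf.mono (Icc_subset_Icc hα.le hβ))
    (fun t ht => (hα.trans_le ht.1).ne') lam

lemma oscInt_add {f : ℝ → ℝ} (hf : ContinuousOn f (Icc 0 1)) (lam : ℝ) {α β γ : ℝ}
    (hα : 0 < α) (hαβ : α ≤ β) (hβγ : β ≤ γ) (hγ : γ ≤ 1) :
    oscInt f lam α β + oscInt f lam β γ = oscInt f lam α γ :=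
  intervalIntegral.integral_add_adjacent_intervals
    (intervalIntegrable_integrand hf lam hα hαβ (hβγ.trans hγ))
    (intervalIntegrable_integrand hf lam (hα.trans_le hαβ) hβγ hγ)

lemma norm_oscInt_le_log (f : ℝ → ℝ) (lam : ℝ) {α β : ℝ} (hα : 0 < α) (hαβ : α ≤ β) :
    ‖oscInt f lam α β‖ ≤ Real.log (β / α) := by
  rw [← integral_one_div_of_pos hα (hα.trans_le hαβ)]
  refine intervalIntegral.norm_integral_le_of_norm_le hαβ ?_ ?_
  · refine ae_of_all _ fun t ht => ?_
    have ht0 : 0 < t := hα.trans ht.1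
    rw [norm_div, norm_exp_phase, Complex.norm_real, Real.norm_of_nonneg ht0.le]
  · apply ContinuousOn.intervalIntegrable
    rw [uIcc_of_le hαβ]
    exact continuousOn_const.div continuousOn_id fun t ht => (hα.trans_le ht.1).ne'

lemma norm_integrand_sub_le {f g : ℝ → ℝ} {lam B t : ℝ} {k : ℕ} (ht : 0 < t)
    (h : |f t - g t| ≤ B * t ^ (k + 1)) :
    ‖Complex.exp (Complex.I * lam * f t) / t - Complex.exp (Complex.I * lam * g t) / t‖ ≤
      |lam| * (B * t ^ k) := by
  rw [← sub_div, norm_div, Complex.norm_real, Real.norm_of_nonneg ht.le, div_le_iff₀ ht]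
  refine (norm_exp_phase_sub_le _ _ _).trans ?_
  rw [mul_assoc]
  refine mul_le_mul_of_nonneg_left (h.trans_eq ?_) (abs_nonneg _)
  ring

lemma norm_oscInt_sub_le {f g : ℝ → ℝ} (hf : ContinuousOn f (Icc 0 1))
    (hg : ContinuousOn g (Icc 0 1)) (lam : ℝ) {B ε δ : ℝ} {k : ℕ} (hB : 0 ≤ B)
    (hε : 0 < ε) (hεδ : ε ≤ δ) (hδ : δ ≤ 1)
    (h : ∀ t ∈ Icc 0 δ, |f t - g t| ≤ B * t ^ (k + 1)) :
    ‖oscInt f lam ε δ - oscInt g lam ε δ‖ ≤ |lam| * (B * δ ^ (k + 1)) := by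
  rw [oscInt, oscInt, ← intervalIntegral.integral_sub
    (intervalIntegrable_integrand hf lam hε hεδ hδ) (intervalIntegrable_integrand hg lam hε hεδ hδ)]
  have hδ0 : 0 < δ := hε.trans_le hεδ
  have key : ∀ t ∈ Set.uIoc ε δ,
      ‖Complex.exp (Complex.I * lam * f t) / t - Complex.exp (Complex.I * lam * g t) / t‖ ≤
      |lam| * (B * δ ^ k) := by
    intro t ht
    rw [uIoc_of_le hεδ] at ht
    have ht0 : 0 < t := hε.trans ht.1
    refine (norm_integrand_sub_le ht0 (h t ⟨ht0.le, ht.2⟩)).trans ?_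
    have := ht.2
    gcongr
  refine (intervalIntegral.norm_integral_le_of_norm_le_const key).trans ?_
  have : |δ - ε| ≤ δ := by rw [abs_of_nonneg (by linarith)]; linarith
  calc |lam| * (B * δ ^ k) * |δ - ε| ≤ |lam| * (B * δ ^ k) * δ := by gcongr
    _ = _ := by ring

lemma truncated_eq (ψ : ℝ → ℝ) (lam ε : ℝ) :
    truncated ψ lam ε = oscInt ψ lam ε 1 - oscInt (fun t => ψ (-t)) lam ε 1 := by
  have h := intervalIntegral.integral_comp_neg (a := ε) (b := 1)
    (fun t : ℝ => Complex.exp (Complex.I * lam * ψ t) / t)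
  rw [truncated, ← h, oscInt, oscInt, sub_eq_neg_add, ← intervalIntegral.integral_neg]
  congr 2
  ext t
  push_cast
  rw [div_neg]

lemma norm_truncated_le {ψ : ℝ → ℝ} (hf : ContinuousOn ψ (Icc 0 1))
    (hg : ContinuousOn (fun t => ψ (-t)) (Icc 0 1)) (lam : ℝ) {B ε δ : ℝ} {k : ℕ} (hB : 0 ≤ B)
    (hε : 0 < ε) (hεδ : ε ≤ δ) (hδ : δ ≤ 1)
    (h : ∀ t ∈ Icc 0 δ, |ψ t - ψ (-t)| ≤ B * t ^ (k + 1)) :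
    ‖truncated ψ lam ε‖ ≤ |lam| * (B * δ ^ (k + 1)) +
      (‖oscInt ψ lam δ 1‖ + ‖oscInt (fun t => ψ (-t)) lam δ 1‖) := by
  rw [truncated_eq, ← oscInt_add hf lam hε hεδ hδ le_rfl, ← oscInt_add hg lam hε hεδ hδ le_rfl,
    add_sub_add_comm]
  exact (norm_add_le _ _).trans
    (add_le_add (norm_oscInt_sub_le hf hg lam hB hε hεδ hδ h) (norm_sub_le _ _))

/-- The folded integrand is bounded by `|λ| B`, hence integrable up to `0`, and its primitive is
continuous there. As `m` is a `limUnder`, the existence of some limit is enough. -/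
lemma tendsto_truncated {ψ : ℝ → ℝ} (hf : ContinuousOn ψ (Icc 0 1))
    (hg : ContinuousOn (fun t => ψ (-t)) (Icc 0 1)) (lam : ℝ) {B : ℝ}
    (h : ∀ t ∈ Icc (0 : ℝ) 1, |ψ t - ψ (-t)| ≤ B * t) :
    Tendsto (truncated ψ lam) (𝓝[>] 0) (𝓝 (m ψ lam)) := by
  set q : ℝ → ℂ := fun t => Complex.exp (Complex.I * lam * ψ t) / t -
    Complex.exp (Complex.I * lam * ψ (-t)) / t with hq
  have hne : ∀ t ∈ Ioc (0 : ℝ) 1, t ≠ 0 := fun t ht => ht.1.ne'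
  have hint : IntegrableOn q (Icc 0 1) := by
    rw [integrableOn_Icc_iff_integrableOn_Ioc]
    refine IntegrableOn.of_bound measure_Ioc_lt_top ?_ (|lam| * B) ?_
    · have hqc : ContinuousOn q (Ioc 0 1) :=
        (continuousOn_integrand (hf.mono Ioc_subset_Icc_self) hne lam).sub
          (continuousOn_integrand (hg.mono Ioc_subset_Icc_self) hne lam)
      exact hqc.aestronglyMeasurable measurableSet_Ioc
    · refine (ae_restrict_iff' measurableSet_Ioc).2 (ae_of_all _ fun t ht => ?_)
      have := norm_integrand_sub_le (f := ψ) (g := fun t => ψ (-t)) (lam := lam) (B := B)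
        (k := 0) ht.1 (by simpa using h t (Ioc_subset_Icc_self ht))
      simpa using this
  have hcont := intervalIntegral.continuousOn_primitive_interval_left (μ := volume) (f := q)
    (a := 0) (b := 1) (by rwa [uIcc_of_le zero_le_one])
  rw [uIcc_of_le zero_le_one] at hcont
  have h0 : Tendsto (fun ε => ∫ t in ε..1, q t) (𝓝[>] 0) (𝓝 (∫ t in (0 : ℝ)..1, q t)) := by
    have h1 := (hcont 0 ⟨le_rfl, zero_le_one⟩).mono (Ioc_subset_Icc_self (a := (0 : ℝ)) (b := 1))
    rwa [ContinuousWithinAt, nhdsWithin_Ioc_eq_nhdsGT (zero_lt_one (α := ℝ))] at h1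
  refine tendsto_nhds_limUnder ⟨_, h0.congr' ?_⟩
  filter_upwards [Ioc_mem_nhdsGT (zero_lt_one (α := ℝ))] with ε hε
  rw [truncated_eq, oscInt, oscInt, ← intervalIntegral.integral_sub
    (intervalIntegrable_integrand hf lam hε.1 hε.2 le_rfl)
    (intervalIntegrable_integrand hg lam hε.1 hε.2 le_rfl)]

/-! ### Integration by parts. -/

/-- Integration by parts against an amplitude `G` with `λ t f'(t) G(t) = 1`, the variation of `G`
being controlled by a decreasing function `W`. -/
lemma norm_oscInt_le_of_deriv {f f' G G' W W' : ℝ → ℝ} {lam α β : ℝ} (hα : 0 < α) (hαβ : α ≤ β)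
    (hf : ContinuousOn f (Icc α β)) (hf' : ∀ t ∈ Ioo α β, HasDerivAt f (f' t) t)
    (hG : ContinuousOn G (Icc α β)) (hG' : ∀ t ∈ Ioo α β, HasDerivAt G (G' t) t)
    (hG'c : ContinuousOn G' (Icc α β))
    (hW : ContinuousOn W (Icc α β)) (hW' : ∀ t ∈ Ioo α β, HasDerivAt W (W' t) t)
    (hW'c : ContinuousOn W' (Icc α β))
    (hmul : ∀ t ∈ Ioo α β, lam * (t * f' t) * G t = 1)
    (hle : ∀ t ∈ Icc α β, |G' t| ≤ -W' t) :
    ‖oscInt f lam α β‖ ≤ |G α| + |G β| + (W α - W β) := by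
  set e : ℝ → ℂ := fun t => Complex.exp (Complex.I * lam * f t) with he
  have hec : ContinuousOn e (Icc α β) := Complex.continuous_exp.comp_continuousOn
    (continuousOn_const.mul (Complex.continuous_ofReal.comp_continuousOn hf))
  have hGc : ContinuousOn (fun t => (G t : ℂ)) (Icc α β) :=
    Complex.continuous_ofReal.comp_continuousOn hG
  have hG'c' : ContinuousOn (fun t => (G' t : ℂ)) (Icc α β) :=
    Complex.continuous_ofReal.comp_continuousOn hG'c
  have hi1 : IntervalIntegrable (fun t : ℝ => e t / t) volume α β := by
    apply ContinuousOn.intervalIntegrable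
    rw [uIcc_of_le hαβ]
    exact continuousOn_integrand hf (fun t ht => (hα.trans_le ht.1).ne') lam
  have hi2 : IntervalIntegrable (fun t : ℝ => Complex.I * (e t * G' t)) volume α β := by
    apply ContinuousOn.intervalIntegrable
    rw [uIcc_of_le hαβ]
    exact continuousOn_const.mul (hec.mul hG'c')
  -- Since `λ f' G = 1/t`, the function `-i e G` has derivative `e/t - i e G'`.
  have hparts : ∫ t in α..β, (e t / t - Complex.I * (e t * G' t)) =
      -Complex.I * (e β * G β) - -Complex.I * (e α * G α) := by
    refine intervalIntegral.integral_eq_sub_of_hasDerivAt_of_le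
      (f := fun t => -Complex.I * (e t * G t)) hαβ
      (continuousOn_const.mul (hec.mul hGc)) ?_ (hi1.sub hi2)
    intro t ht
    have ht0 : (t : ℂ) ≠ 0 := by exact_mod_cast (hα.trans ht.1).ne'
    have h1 : HasDerivAt e (e t * (Complex.I * lam * f' t)) t :=
      (((hf' t ht).ofReal_comp).const_mul (Complex.I * (lam : ℂ))).cexp
    have h2 := (h1.mul (hG' t ht).ofReal_comp).const_mul (-Complex.I)
    refine h2.congr_deriv ?_
    have h3 : (lam : ℂ) * (t * f' t) * G t = 1 := by exact_mod_cast hmul t ht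
    have h4 : (lam : ℂ) * f' t * G t = 1 / t := by
      rw [eq_div_iff ht0, ← h3]; ring
    rw [div_eq_mul_one_div, ← h4]
    linear_combination (-(e t * (lam * f' t * G t))) * Complex.I_sq
  have hWint : ∫ t in α..β, -W' t = W α - W β := by
    rw [intervalIntegral.integral_neg, intervalIntegral.integral_eq_sub_of_hasDerivAt_of_le hαβ hW
      hW' (by apply ContinuousOn.intervalIntegrable; rwa [uIcc_of_le hαβ]), neg_sub]
  have hrem : ‖∫ t in α..β, Complex.I * (e t * G' t)‖ ≤ W α - W β := by
    rw [← hWint]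
    refine intervalIntegral.norm_integral_le_of_norm_le hαβ (ae_of_all _ fun t ht => ?_) ?_
    · rw [norm_mul, norm_mul, Complex.norm_I, norm_exp_phase, Complex.norm_real, one_mul, one_mul]
      exact hle t (Ioc_subset_Icc_self ht)
    · apply ContinuousOn.intervalIntegrable
      rw [uIcc_of_le hαβ]
      exact hW'c.neg
  have hbd : ∀ t, ‖-Complex.I * (e t * G t)‖ = |G t| := fun t => by
    rw [norm_mul, norm_mul, norm_neg, Complex.norm_I, norm_exp_phase, Complex.norm_real, one_mul,
      one_mul, Real.norm_eq_abs]
  rw [intervalIntegral.integral_sub hi1 hi2, sub_eq_iff_eq_add] at hparts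
  rw [oscInt, hparts]
  refine (norm_add_le _ _).trans (add_le_add ((norm_sub_le _ _).trans_eq ?_) hrem)
  rw [hbd, hbd, add_comm]

/-! ### Jets on `[0,1]` and phases of finite type. -/

/-- `g` is a sequence of functions on `[0,1]`, each the derivative of the preceding one. -/
def IsJet (g : ℕ → ℝ → ℝ) : Prop :=
  ∀ j, ∀ t ∈ Icc (0 : ℝ) 1, HasDerivWithinAt (g j) (g (j + 1) t) (Icc 0 1) t

lemma IsJet.continuousOn {g : ℕ → ℝ → ℝ} (hg : IsJet g) (j : ℕ) :
    ContinuousOn (g j) (Icc 0 1) := fun t ht => (hg j t ht).continuousWithinAt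

lemma IsJet.hasDerivAt {g : ℕ → ℝ → ℝ} (hg : IsJet g) (j : ℕ) {t : ℝ} (ht : t ∈ Ioo (0 : ℝ) 1) :
    HasDerivAt (g j) (g (j + 1) t) t :=
  (hg j t (Ioo_subset_Icc_self ht)).hasDerivAt (Icc_mem_nhds ht.1 ht.2)

lemma IsJet.shift {g : ℕ → ℝ → ℝ} (hg : IsJet g) (i : ℕ) : IsJet fun j => g (j + i) := by
  intro j t ht
  have := hg (j + i) t ht
  rwa [show j + i + 1 = j + 1 + i by omega] at this

lemma IsJet.bound_step {g : ℕ → ℝ → ℝ} (hg : IsJet g) {j n : ℕ} {M : ℝ} (hM : 0 ≤ M)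
    (h : ∀ t ∈ Icc (0 : ℝ) 1, |g (j + 1) t| ≤ M * t ^ n) {t : ℝ} (ht : t ∈ Icc (0 : ℝ) 1) :
    |g j t - g j 0| ≤ M * t ^ (n + 1) := by
  have hsub : Icc 0 t ⊆ Icc 0 1 := Icc_subset_Icc le_rfl ht.2
  have := (convex_Icc (0 : ℝ) t).norm_image_sub_le_of_norm_hasDerivWithin_le (C := M * t ^ n)
    (fun x hx => (hg j x (hsub hx)).mono hsub)
    (fun x hx => (h x (hsub hx)).trans (by have := hx.1; have := hx.2; gcongr))
    ⟨le_rfl, ht.1⟩ ⟨ht.1, le_rfl⟩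
  rw [Real.norm_eq_abs, Real.norm_eq_abs, sub_zero, abs_of_nonneg ht.1] at this
  rw [pow_succ, ← mul_assoc]
  exact this

/-- A function vanishing to order `n` at `0` is bounded by `sup |g⁽ⁿ⁾| tⁿ`. -/
lemma IsJet.bound {n : ℕ} : ∀ {g : ℕ → ℝ → ℝ}, IsJet g → ∀ {M : ℝ}, 0 ≤ M →
    (∀ j < n, g j 0 = 0) → (∀ t ∈ Icc (0 : ℝ) 1, |g n t| ≤ M) →
    ∀ t ∈ Icc (0 : ℝ) 1, |g 0 t| ≤ M * t ^ n := by
  induction n with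
  | zero => intro g _ M _ _ h t ht; simpa using h t ht
  | succ n ih =>
    intro g hg M hM h0 h t ht
    have := hg.bound_step (j := 0) hM
      (ih (hg.shift 1) hM (fun j hj => h0 (j + 1) (by omega)) h) ht
    rwa [h0 0 (by omega), sub_zero] at this

/-- The jet of `t ↦ A tⁿ / n!`. -/
noncomputable def monomialJet (A : ℝ) (n j : ℕ) (t : ℝ) : ℝ :=
  if j ≤ n then A * t ^ (n - j) / (n - j)! else 0

lemma isJet_monomialJet (A : ℝ) (n : ℕ) : IsJet (monomialJet A n) := by
  intro j t _
  apply HasDerivAt.hasDerivWithinAt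
  unfold monomialJet
  rcases lt_trichotomy j n with h | h | h
  · obtain ⟨d, rfl⟩ : ∃ d, n = j + 1 + d := ⟨n - (j + 1), by omega⟩
    simp only [show j ≤ j + 1 + d by omega, show j + 1 ≤ j + 1 + d by omega, if_true,
      show j + 1 + d - j = d + 1 by omega, show j + 1 + d - (j + 1) = d by omega]
    refine (((hasDerivAt_pow (d + 1) t).const_mul A).div_const _).congr_deriv ?_
    have : (d ! : ℝ) ≠ 0 := by positivity
    rw [Nat.factorial_succ]
    push_cast
    field_simp
  · subst h
    simpa using hasDerivAt_const t (A : ℝ)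
  · simpa [not_le.2 h, show ¬ j + 1 ≤ n by omega] using hasDerivAt_const t (0 : ℝ)

lemma IsJet.sub {g h : ℕ → ℝ → ℝ} (hg : IsJet g) (hh : IsJet h) :
    IsJet fun j t => g j t - h j t := fun j t ht => (hg j t ht).sub (hh j t ht)

lemma IsJet.exists_bound {g : ℕ → ℝ → ℝ} (hg : IsJet g) (j : ℕ) :
    ∃ M : ℝ, 0 ≤ M ∧ ∀ t ∈ Icc (0 : ℝ) 1, |g j t| ≤ M := by
  obtain ⟨M, hM⟩ := isCompact_Icc.exists_bound_of_continuousOn (hg.continuousOn j)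
  exact ⟨M, (abs_nonneg _).trans (hM 0 ⟨le_rfl, zero_le_one⟩), hM⟩

lemma IsJet.exists_upper {g : ℕ → ℝ → ℝ} (hg : IsJet g) (n : ℕ) (h0 : ∀ j < n, g j 0 = 0) :
    ∃ M : ℝ, 0 ≤ M ∧ ∀ t ∈ Icc (0 : ℝ) 1, |g 0 t| ≤ M * t ^ n := by
  obtain ⟨M, hM, h⟩ := hg.exists_bound n
  exact ⟨M, hM, hg.bound hM h0 h⟩

/-- A function vanishing to order exactly `n` at `0` is bounded below by `c tⁿ` near `0`. -/
lemma IsJet.exists_lower {g : ℕ → ℝ → ℝ} (hg : IsJet g) (n : ℕ) (h0 : ∀ j < n, g j 0 = 0)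
    (hn : g n 0 ≠ 0) :
    ∃ c > 0, ∃ d > 0, d < 1 ∧ ∀ t ∈ Icc (0 : ℝ) d, c * t ^ n ≤ |g 0 t| := by
  -- Subtracting the leading Taylor monomial leaves a jet vanishing to order `n + 1`, so an error `M
  -- t^(n+1)`; near `0` this is at most half the monomial.
  obtain ⟨M, hM, hb⟩ := (hg.sub (isJet_monomialJet (g n 0) n)).exists_upper (n + 1) (by
    intro j hj
    rcases (Nat.lt_succ_iff.1 hj).lt_or_eq with h | h
    · simp [monomialJet, h.le, h0 j h, show n - j ≠ 0 by omega]
    · subst h; simp [monomialJet])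
  set a := |g n 0| / n ! with ha
  have ha0 : 0 < a := by positivity
  refine ⟨a / 2, by positivity, min (1 / 2) (a / (2 * (M + 1))), by positivity,
    (min_le_left _ _).trans_lt (by norm_num), fun t ht => ?_⟩
  have ht1 : t ≤ 1 / 2 := ht.2.trans (min_le_left _ _)
  have ht2 : t ≤ a / (2 * (M + 1)) := ht.2.trans (min_le_right _ _)
  rw [le_div_iff₀ (by positivity)] at ht2
  have h1 := hb t ⟨ht.1, by linarith⟩
  have h2 : |monomialJet (g n 0) n 0 t| = a * t ^ n := by
    have := ht.1
    simp only [monomialJet, Nat.zero_le, if_true, Nat.sub_zero, abs_div, abs_mul, abs_pow,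
      abs_of_nonneg ht.1, Nat.abs_cast, ha]
    ring
  have h3 : |monomialJet (g n 0) n 0 t| ≤ |g 0 t| + |g 0 t - monomialJet (g n 0) n 0 t| := by
    have := abs_sub (g 0 t) (g 0 t - monomialJet (g n 0) n 0 t)
    simpa using this
  have h4 : M * t ^ (n + 1) ≤ a / 2 * t ^ n := by
    have h5 : 0 ≤ t ^ n := pow_nonneg ht.1 _
    have h6 : M * t ≤ a / 2 := by have := ht.1; nlinarith
    calc M * t ^ (n + 1) = M * t * t ^ n := by ring
      _ ≤ _ := by gcongr
  linarith

/-- Finite type: the oscillatory integral over `[δ,1]` is bounded as long as `λ δᵏ ≥ 1`. -/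
lemma IsJet.norm_oscInt_le {g : ℕ → ℝ → ℝ} (hg : IsJet g) (n : ℕ)
    (h0 : ∀ j < n, g (j + 1) 0 = 0) (hn : g (n + 1) 0 ≠ 0) :
    ∃ C : ℝ, ∀ lam δ : ℝ, 0 < lam → 0 < δ → δ ≤ 1 → 1 ≤ lam * δ ^ (n + 1) →
      ‖oscInt (g 0) lam δ 1‖ ≤ C := by
  obtain ⟨c, hc, d, hd, hd1, hlow⟩ := (hg.shift 1).exists_lower n h0 hn
  simp only [zero_add] at hlow
  obtain ⟨M, hM, hup⟩ : ∃ M : ℝ, 0 ≤ M ∧ ∀ t ∈ Icc (0 : ℝ) 1, |g 1 t + t * g 2 t| ≤ M * t ^ n := by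
    obtain ⟨M₁, hM₁, h1⟩ := (hg.shift 1).exists_upper n h0
    -- For `n = 0` the truncated exponent `n - 1` is `0`; the comparison `t * t^(n-1) ≤ t^n` still
    -- holds because `t ≤ 1`.
    obtain ⟨M₂, hM₂, h2⟩ := (hg.shift 2).exists_upper (n - 1)
      (fun j hj => h0 (j + 1) (by omega))
    refine ⟨M₁ + M₂, by positivity, fun t ht => ?_⟩
    have h3 : t * t ^ (n - 1) ≤ t ^ n := by
      rw [← pow_succ']
      exact pow_le_pow_of_le_one ht.1 ht.2 (by omega)
    have h4 := h1 t ht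
    have h5 := h2 t ht
    simp only [zero_add] at h4 h5
    calc |g 1 t + t * g 2 t| ≤ |g 1 t| + |t * g 2 t| := abs_add_le _ _
      _ ≤ M₁ * t ^ n + t * (M₂ * t ^ (n - 1)) := by
        rw [abs_mul, abs_of_nonneg ht.1]
        have := ht.1
        gcongr
      _ = M₁ * t ^ n + M₂ * (t * t ^ (n - 1)) := by ring
      _ ≤ M₁ * t ^ n + M₂ * t ^ n := by gcongr
      _ = _ := by ring
  have hld : 0 ≤ Real.log (1 / d) := Real.log_nonneg (by rw [le_div_iff₀ hd]; linarith)
  refine ⟨2 / c + M / c ^ 2 + Real.log (1 / d), fun lam δ hlam hδ hδ1 hbig => ?_⟩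
  rcases le_total d δ with hdδ | hδd
  · have h1 := norm_oscInt_le_log (g 0) lam hδ hδ1
    have h2 : Real.log (1 / δ) ≤ Real.log (1 / d) := by gcongr
    have : 0 ≤ 2 / c + M / c ^ 2 := by positivity
    linarith
  have hsub : Icc δ d ⊆ Icc 0 1 := Icc_subset_Icc hδ.le hd1.le
  have hpos : ∀ t ∈ Icc δ d, 0 < t := fun t ht => hδ.trans_le ht.1
  have hIoo : ∀ t ∈ Ioo δ d, t ∈ Ioo (0 : ℝ) 1 := fun t ht => ⟨hδ.trans ht.1, ht.2.trans hd1⟩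
  have hlb : ∀ t ∈ Icc δ d, c * t ^ (n + 1) ≤ |t * g 1 t| := fun t ht => by
    rw [abs_mul, abs_of_pos (hpos t ht)]
    have := hlow t ⟨(hpos t ht).le, ht.2⟩
    have := mul_le_mul_of_nonneg_left this (hpos t ht).le
    calc _ = t * (c * t ^ n) := by ring
      _ ≤ _ := this
  have hne : ∀ t ∈ Icc δ d, t * g 1 t ≠ 0 := fun t ht => by
    have h1 := hlb t ht
    have h2 : 0 < c * t ^ (n + 1) := by have := hpos t ht; positivity
    exact abs_pos.1 (h2.trans_le h1)
  have hc0 := (hg.continuousOn 0).mono hsub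
  have hc1 := (hg.continuousOn 1).mono hsub
  have hc2 := (hg.continuousOn 2).mono hsub
  have hmain : ‖oscInt (g 0) lam δ d‖ ≤
      |(lam * (δ * g 1 δ))⁻¹| + |(lam * (d * g 1 d))⁻¹| +
        (M / c ^ 2 * (lam * δ ^ (n + 1))⁻¹ - M / c ^ 2 * (lam * d ^ (n + 1))⁻¹) := by
    -- The bounds on `t f'` and `(t f')'` give `|G'| ≤ (M/c²) t^(-n-2)/λ`, which `-W'` dominates
    -- with a factor `n + 1` to spare.
    refine norm_oscInt_le_of_deriv (f' := g 1) (G := fun t => (lam * (t * g 1 t))⁻¹)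
      (G' := fun t => -(lam * (g 1 t + t * g 2 t)) / (lam * (t * g 1 t)) ^ 2)
      (W := fun t => M / c ^ 2 * (lam * t ^ (n + 1))⁻¹)
      (W' := fun t => M / c ^ 2 * (-(lam * ((n + 1 : ℕ) * t ^ n)) / (lam * t ^ (n + 1)) ^ 2))
      hδ hδd hc0 (fun t ht => hg.hasDerivAt 0 (hIoo t ht)) ?_ ?_ ?_ ?_ ?_ ?_ ?_ ?_
    · exact (continuousOn_const.mul (continuousOn_id.mul hc1)).inv₀
        fun t ht => mul_ne_zero hlam.ne' (hne t ht)
    · intro t ht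
      have h := (((hasDerivAt_id t).mul (hg.hasDerivAt 1 (hIoo t ht))).const_mul lam).inv
        (mul_ne_zero hlam.ne' (hne t (Ioo_subset_Icc_self ht)))
      refine h.congr_deriv ?_
      simp
    · exact ((continuousOn_const.mul (hc1.add (continuousOn_id.mul hc2))).neg).div
        ((continuousOn_const.mul (continuousOn_id.mul hc1)).pow 2)
        fun t ht => pow_ne_zero _ (mul_ne_zero hlam.ne' (hne t ht))
    · refine continuousOn_const.mul (ContinuousOn.inv₀ (by fun_prop) fun t ht => ?_)
      have := hpos t ht
      positivity
    · intro t ht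
      have htp := hpos t (Ioo_subset_Icc_self ht)
      exact (((hasDerivAt_pow (n + 1) t).const_mul lam).inv (by positivity)).const_mul _
    · refine continuousOn_const.mul (ContinuousOn.div (by fun_prop) (by fun_prop) fun t ht => ?_)
      have := hpos t ht
      positivity
    · intro t ht
      have h1 := hne t (Ioo_subset_Icc_self ht)
      exact mul_inv_cancel₀ (mul_ne_zero hlam.ne' h1)
    · intro t ht
      have htp := hpos t ht
      have h1 := hup t (hsub ht)
      have h2 := hlb t ht
      rw [abs_div, abs_neg, abs_mul, abs_pow, abs_mul lam, abs_of_pos hlam, neg_div, mul_neg,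
        neg_neg]
      calc lam * |g 1 t + t * g 2 t| / (lam * |t * g 1 t|) ^ 2
          ≤ lam * (M * t ^ n) / (lam * (c * t ^ (n + 1))) ^ 2 := by gcongr
        _ = M / c ^ 2 * (lam * (1 * t ^ n) / (lam * t ^ (n + 1)) ^ 2) := by
          field_simp
        _ ≤ _ := by
          gcongr
          norm_num
  have hG : ∀ t ∈ Icc δ d, |(lam * (t * g 1 t))⁻¹| ≤ 1 / c := by
    intro t ht
    have h1 := hlb t ht
    have hlt : 1 ≤ lam * t ^ (n + 1) := hbig.trans (by have := ht.1; gcongr)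
    rw [abs_inv, abs_mul, abs_of_pos hlam, one_div]
    apply inv_anti₀ hc
    calc c = c * 1 := by ring
      _ ≤ c * (lam * t ^ (n + 1)) := by gcongr
      _ = lam * (c * t ^ (n + 1)) := by ring
      _ ≤ _ := by gcongr
  have h1 := hG δ ⟨le_rfl, hδd⟩
  have h2 := hG d ⟨hδd, le_rfl⟩
  have h3 : M / c ^ 2 * (lam * δ ^ (n + 1))⁻¹ ≤ M / c ^ 2 :=
    mul_le_of_le_one_right (by positivity) (inv_le_one_of_one_le₀ hbig)
  have h4 : 0 ≤ M / c ^ 2 * (lam * d ^ (n + 1))⁻¹ := by positivity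
  have h5 := norm_oscInt_le_log (g 0) lam hd hd1.le
  rw [← oscInt_add (hg.continuousOn 0) lam hδ hδd hd1.le le_rfl]
  refine (norm_add_le _ _).trans ?_
  have h6 : 2 / c = 1 / c + 1 / c := by ring
  linarith

/-! ### Smooth phases: existence of `m` and the splitting at `δ`. -/

lemma hasDerivWithinAt_iteratedDerivWithin {ψ : ℝ → ℝ} (hψ : ContDiffOn ℝ ∞ ψ (Icc (-1) 1))
    (j : ℕ) {t : ℝ} (ht : t ∈ Icc (-1 : ℝ) 1) :
    HasDerivWithinAt (iteratedDerivWithin j ψ (Icc (-1) 1))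
      (iteratedDerivWithin (j + 1) ψ (Icc (-1) 1) t) (Icc (-1) 1) t := by
  rw [iteratedDerivWithin_succ]
  exact (hψ.differentiableOn_iteratedDerivWithin (by exact_mod_cast WithTop.coe_lt_top j)
    (uniqueDiffOn_Icc (by norm_num)) t ht).hasDerivWithinAt

lemma isJet_pos {ψ : ℝ → ℝ} (hψ : ContDiffOn ℝ ∞ ψ (Icc (-1) 1)) :
    IsJet fun j => iteratedDerivWithin j ψ (Icc (-1) 1) := by
  intro j t ht
  have hsub : Icc (0 : ℝ) 1 ⊆ Icc (-1) 1 := Icc_subset_Icc (by norm_num) le_rfl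
  exact (hasDerivWithinAt_iteratedDerivWithin hψ j (hsub ht)).mono hsub

lemma isJet_neg {ψ : ℝ → ℝ} (hψ : ContDiffOn ℝ ∞ ψ (Icc (-1) 1)) :
    IsJet fun j t => (-1) ^ j * iteratedDerivWithin j ψ (Icc (-1) 1) (-t) := by
  intro j t ht
  have hmaps : MapsTo (fun t : ℝ => -t) (Icc 0 1) (Icc (-1) 1) := fun x hx =>
    ⟨by linarith [hx.2], by linarith [hx.1]⟩
  have h := ((hasDerivWithinAt_iteratedDerivWithin hψ j (hmaps ht)).scomp t
    (hasDerivAt_neg t).hasDerivWithinAt hmaps).const_mul ((-1) ^ j)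
  refine h.congr_deriv ?_
  simp [pow_succ]

/-- The odd difference of a function whose derivatives of orders `1, …, n` vanish at `0`. -/
lemma abs_sub_neg_le {ψ : ℝ → ℝ} (hψ : ContDiffOn ℝ ∞ ψ (Icc (-1) 1)) {n : ℕ} {M : ℝ}
    (hM : 0 ≤ M) (h0 : ∀ j < n, iteratedDerivWithin (j + 1) ψ (Icc (-1) 1) 0 = 0)
    (hb : ∀ t ∈ Icc (-1 : ℝ) 1, |iteratedDerivWithin (n + 1) ψ (Icc (-1) 1) t| ≤ M)
    {t : ℝ} (ht : t ∈ Icc (0 : ℝ) 1) : |ψ t - ψ (-t)| ≤ 2 * M * t ^ (n + 1) := by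
  have h1 := (isJet_pos hψ).bound_step (j := 0) hM
    (((isJet_pos hψ).shift 1).bound hM h0
      (fun t ht => hb t ⟨by linarith [ht.1], ht.2⟩)) ht
  have h2 := (isJet_neg hψ).bound_step (j := 0) hM
    (((isJet_neg hψ).shift 1).bound hM (n := n) (fun j hj => by simp [h0 j hj])
      (fun t ht => by
        rw [abs_mul, abs_pow, abs_neg, abs_one, one_pow, one_mul]
        exact hb (-t) ⟨by linarith [ht.2], by linarith [ht.1]⟩)) ht
  simp only [iteratedDerivWithin_zero, pow_zero, one_mul, neg_zero] at h1 h2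
  calc |ψ t - ψ (-t)| = |(ψ t - ψ 0) - (ψ (-t) - ψ 0)| := by congr 1; ring
    _ ≤ |ψ t - ψ 0| + |ψ (-t) - ψ 0| := abs_sub _ _
    _ ≤ _ := by linarith

lemma continuousOn_pos {ψ : ℝ → ℝ} (hψ : ContDiffOn ℝ ∞ ψ (Icc (-1) 1)) :
    ContinuousOn ψ (Icc 0 1) := by
  simpa using (isJet_pos hψ).continuousOn 0

lemma continuousOn_neg {ψ : ℝ → ℝ} (hψ : ContDiffOn ℝ ∞ ψ (Icc (-1) 1)) :
    ContinuousOn (fun t => ψ (-t)) (Icc 0 1) := by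
  simpa using (isJet_neg hψ).continuousOn 0

lemma exists_iteratedDerivWithin_bound {ψ : ℝ → ℝ} (hψ : ContDiffOn ℝ ∞ ψ (Icc (-1) 1)) (n : ℕ) :
    ∃ M : ℝ, 0 ≤ M ∧ ∀ t ∈ Icc (-1 : ℝ) 1, |iteratedDerivWithin n ψ (Icc (-1) 1) t| ≤ M := by
  obtain ⟨M, hM⟩ := isCompact_Icc.exists_bound_of_continuousOn
    (fun t ht => (hasDerivWithinAt_iteratedDerivWithin hψ n ht).continuousWithinAt)
  exact ⟨M, (abs_nonneg _).trans (hM 0 (by norm_num)), hM⟩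

/-- The principal value exists for smooth phases. -/
lemma tendsto_truncated_m {ψ : ℝ → ℝ} (hψ : ContDiffOn ℝ ∞ ψ (Icc (-1) 1)) (lam : ℝ) :
    Tendsto (truncated ψ lam) (𝓝[>] 0) (𝓝 (m ψ lam)) := by
  obtain ⟨M, hM, hb⟩ := exists_iteratedDerivWithin_bound hψ 1
  refine tendsto_truncated (continuousOn_pos hψ) (continuousOn_neg hψ) lam (B := 2 * M)
    fun t ht => ?_
  simpa using abs_sub_neg_le hψ (n := 0) hM (by simp) hb ht

lemma norm_m_le {ψ : ℝ → ℝ} (hψ : ContDiffOn ℝ ∞ ψ (Icc (-1) 1)) {lam M δ : ℝ} {n : ℕ}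
    (hlam : 0 ≤ lam) (hM : 0 ≤ M) (hδ : 0 < δ) (hδ1 : δ ≤ 1)
    (h0 : ∀ j < n, iteratedDerivWithin (j + 1) ψ (Icc (-1) 1) 0 = 0)
    (hb : ∀ t ∈ Icc (-1 : ℝ) 1, |iteratedDerivWithin (n + 1) ψ (Icc (-1) 1) t| ≤ M) :
    ‖m ψ lam‖ ≤ lam * (2 * M * δ ^ (n + 1)) +
      (‖oscInt ψ lam δ 1‖ + ‖oscInt (fun t => ψ (-t)) lam δ 1‖) := by
  refine le_of_tendsto (tendsto_truncated_m hψ lam).norm ?_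
  filter_upwards [Ioc_mem_nhdsGT hδ] with ε hε
  have := norm_truncated_le (continuousOn_pos hψ) (continuousOn_neg hψ) lam (B := 2 * M)
    (by positivity) hε.1 hε.2 hδ1
    fun t ht => abs_sub_neg_le hψ hM h0 hb ⟨ht.1, ht.2.trans hδ1⟩
  rwa [abs_of_nonneg hlam] at this

/-! ### The upper bound. -/

lemma tendsto_log_log : Tendsto (fun lam : ℝ => Real.log (Real.log lam)) atTop atTop :=
  Real.tendsto_log_atTop.comp Real.tendsto_log_atTop

lemma isBigO_log_log {f : ℝ → ℂ} {C D : ℝ}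
    (h : ∀ᶠ lam in atTop, ‖f lam‖ ≤ C + D * Real.log (Real.log lam)) :
    f =O[atTop] fun lam : ℝ => Real.log (Real.log lam) := by
  refine Asymptotics.IsBigO.of_bound (|C| + D) ?_
  filter_upwards [h, tendsto_log_log.eventually_ge_atTop 1] with lam h1 h2
  rw [Real.norm_of_nonneg (by linarith)]
  have h3 : C ≤ |C| * Real.log (Real.log lam) :=
    (le_abs_self C).trans (le_mul_of_one_le_right (abs_nonneg _) h2)
  linarith

lemma isBigO_m_of_finite_type {ψ : ℝ → ℝ} (hψ : ContDiffOn ℝ ∞ ψ (Icc (-1) 1)) {n : ℕ}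
    (h0 : ∀ j < n, iteratedDerivWithin (j + 1) ψ (Icc (-1) 1) 0 = 0)
    (hn : iteratedDerivWithin (n + 1) ψ (Icc (-1) 1) 0 ≠ 0) :
    m ψ =O[atTop] fun lam : ℝ => Real.log (Real.log lam) := by
  obtain ⟨C₁, h1⟩ := (isJet_pos hψ).norm_oscInt_le n h0 hn
  obtain ⟨C₂, h2⟩ := (isJet_neg hψ).norm_oscInt_le n (fun j hj => by simp [h0 j hj])
    (by simpa using hn)
  simp only [iteratedDerivWithin_zero, pow_zero, one_mul] at h1 h2
  obtain ⟨M, hM, hb⟩ := exists_iteratedDerivWithin_bound hψ (n + 1)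
  refine isBigO_log_log (C := 2 * M + (C₁ + C₂)) (D := 0) ?_
  filter_upwards [eventually_ge_atTop 1] with lam hlam
  have hlam0 : 0 < lam := by linarith
  have hpow : lam * (lam ^ (-((n + 1 : ℕ) : ℝ)⁻¹)) ^ (n + 1) = 1 := by
    rw [← Real.rpow_natCast, ← Real.rpow_mul hlam0.le, neg_mul, inv_mul_cancel₀ (by positivity),
      Real.rpow_neg_one, mul_inv_cancel₀ hlam0.ne']
  set δ := lam ^ (-((n + 1 : ℕ) : ℝ)⁻¹) with hδ
  have hδ0 : 0 < δ := Real.rpow_pos_of_pos hlam0 _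
  have hδ1 : δ ≤ 1 := Real.rpow_le_one_of_one_le_of_nonpos hlam (by
    rw [neg_nonpos]; positivity)
  have h3 := norm_m_le hψ hlam0.le hM hδ0 hδ1 h0 hb
  have h4 : lam * (2 * M * δ ^ (n + 1)) = 2 * M := by
    calc _ = 2 * M * (lam * δ ^ (n + 1)) := by ring
      _ = _ := by rw [hpow, mul_one]
  have h5 := h1 lam δ hlam0 hδ0 hδ1 hpow.ge
  have h6 := h2 lam δ hlam0 hδ0 hδ1 hpow.ge
  linarith

lemma isBigO_m_of_flat {s : ℝ} (hs : 0 ≤ s) {ψ : ℝ → ℝ} (hG : Gevrey s ψ)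
    (h0 : ∀ j, iteratedDerivWithin (j + 1) ψ (Icc (-1) 1) 0 = 0) :
    m ψ =O[atTop] fun lam : ℝ => Real.log (Real.log lam) := by
  obtain ⟨hψ, K₀, hK₀, hK₀b⟩ := hG
  set K := max K₀ 1 with hKdef
  have hK : 1 ≤ K := le_max_right _ _
  have hK0 : 0 < K := by linarith
  refine isBigO_log_log (C := 2 * K + 2 * (1 + Real.log K + s * Real.log 2)) (D := 2 * s) ?_
  filter_upwards [eventually_ge_atTop (Real.exp 1)] with lam hlam
  have hlam0 : 0 < lam := (Real.exp_pos 1).trans_le hlam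
  have hL : 1 ≤ Real.log lam := by rwa [Real.le_log_iff_exp_le hlam0]
  obtain ⟨n, hn⟩ : ∃ n : ℕ, ⌈Real.log lam⌉₊ = n + 1 :=
    Nat.exists_eq_succ_of_ne_zero (Nat.ceil_pos.2 (by linarith)).ne'
  have hn1 : Real.log lam ≤ ((n + 1 : ℕ) : ℝ) := hn ▸ Nat.le_ceil _
  have hn2 : ((n + 1 : ℕ) : ℝ) ≤ 2 * Real.log lam := by
    have := Nat.ceil_lt_add_one (show 0 ≤ Real.log lam by linarith)
    rw [hn] at this
    linarith
  set N : ℝ := ((n + 1 : ℕ) : ℝ) with hN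
  have hN1 : 1 ≤ N := hL.trans hn1
  have hNs : 1 ≤ N ^ s := Real.one_le_rpow hN1 hs
  -- Here `δ = 1/R`. Since `(n+1)! ≤ N^(n+1)`, the Gevrey bound times `R^(-(n+1))` is at most `K
  -- e^(-(n+1)) ≤ K/λ`.
  set R := Real.exp 1 * K * N ^ s with hR
  have hR1 : 1 ≤ R := by
    have := Real.one_le_exp (zero_le_one)
    exact one_le_mul_of_one_le_of_one_le (one_le_mul_of_one_le_of_one_le this hK) hNs
  have hR0 : 0 < R := by linarith
  have h1 := norm_m_le hψ (M := K ^ (n + 2) * (((n + 1)! : ℕ) : ℝ) ^ s) (n := n) (δ := R⁻¹)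
    hlam0.le (by positivity) (by positivity) (inv_le_one_of_one_le₀ hR1) (fun j _ => h0 j)
    (fun t ht => (hK₀b (n + 1) t ht).trans (by
      gcongr
      exact le_max_left _ _))
  have h2 := norm_oscInt_le_log ψ lam (inv_pos.2 hR0) (inv_le_one_of_one_le₀ hR1)
  have h3 := norm_oscInt_le_log (fun t => ψ (-t)) lam (inv_pos.2 hR0) (inv_le_one_of_one_le₀ hR1)
  rw [one_div, inv_inv] at h2 h3
  have h4 : Real.log R ≤ 1 + Real.log K + s * (Real.log 2 + Real.log (Real.log lam)) := by
    rw [hR, Real.log_mul (by positivity) (by positivity), Real.log_mul (by positivity)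
      (by positivity), Real.log_exp, Real.log_rpow (by linarith),
      ← Real.log_mul (by norm_num) (by linarith)]
    gcongr
  have h5 : lam * (2 * (K ^ (n + 2) * (((n + 1)! : ℕ) : ℝ) ^ s) * R⁻¹ ^ (n + 1)) ≤ 2 * K := by
    have hfac : (((n + 1)! : ℕ) : ℝ) ^ s ≤ (N ^ s) ^ (n + 1) := by
      rw [← Real.rpow_natCast, ← Real.rpow_mul (by linarith), mul_comm s, Real.rpow_mul
        (by linarith), Real.rpow_natCast]
      gcongr
      rw [hN]
      exact_mod_cast Nat.factorial_le_pow (n + 1)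
    have hexp : lam ≤ Real.exp 1 ^ (n + 1) := by
      rw [← Real.exp_nat_mul, mul_one, ← Real.log_le_iff_le_exp hlam0]
      exact hn1
    calc lam * (2 * (K ^ (n + 2) * (((n + 1)! : ℕ) : ℝ) ^ s) * R⁻¹ ^ (n + 1))
        ≤ Real.exp 1 ^ (n + 1) * (2 * (K ^ (n + 2) * (N ^ s) ^ (n + 1)) * R⁻¹ ^ (n + 1)) := by
          gcongr
      _ = 2 * K * (R * R⁻¹) ^ (n + 1) := by rw [hR]; ring
      _ = 2 * K := by rw [mul_inv_cancel₀ hR0.ne', one_pow, mul_one]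
  linarith

lemma Gevrey.isBigO_m {s : ℝ} (hs : 0 ≤ s) {ψ : ℝ → ℝ} (hG : Gevrey s ψ) :
    m ψ =O[atTop] fun lam : ℝ => Real.log (Real.log lam) := by
  by_cases h : ∃ n, iteratedDerivWithin (n + 1) ψ (Icc (-1) 1) 0 ≠ 0
  · classical
    exact isBigO_m_of_finite_type hG.1 (fun j hj => not_not.1 (Nat.find_min h hj))
      (Nat.find_spec h)
  · push Not at h
    exact isBigO_m_of_flat hs hG h

/-! ### The flat phase is Gevrey. -/

/-- The holomorphic extension `exp(-z^{-a})` of the flat phase to the slit plane. -/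
noncomputable def flatExt (a : ℝ) (z : ℂ) : ℂ := Complex.exp (-(z ^ (-(a : ℂ))))

/-- The candidate for the `n`-th derivative of the flat phase. -/
noncomputable def flatDeriv (a : ℝ) (n : ℕ) (t : ℝ) : ℝ :=
  if 0 < t then (iteratedDeriv n (flatExt a) t).re else 0

lemma flatDeriv_zero (a t : ℝ) :
    flatDeriv a 0 t = if 0 < t then Real.exp (-(t ^ (-a))) else 0 := by
  unfold flatDeriv
  split_ifs with ht
  · rw [iteratedDeriv_zero, flatExt, ← Complex.ofReal_neg a, ← Complex.ofReal_cpow ht.le,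
      ← Complex.ofReal_neg, ← Complex.ofReal_exp, Complex.ofReal_re]
  · rfl

lemma differentiableAt_flatExt (a : ℝ) {z : ℂ} (hz : z ∈ Complex.slitPlane) :
    DifferentiableAt ℂ (flatExt a) z :=
  ((differentiableAt_id.cpow_const hz).neg).cexp

lemma analyticAt_flatExt (a : ℝ) {z : ℂ} (hz : z ∈ Complex.slitPlane) :
    AnalyticAt ℂ (flatExt a) z :=
  DifferentiableOn.analyticAt
    (fun _ hw => (differentiableAt_flatExt a hw).differentiableWithinAt)
    (Complex.isOpen_slitPlane.mem_nhds hz)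

lemma hasDerivAt_iteratedDeriv_flatExt (a : ℝ) (n : ℕ) {z : ℂ} (hz : z ∈ Complex.slitPlane) :
    HasDerivAt (iteratedDeriv n (flatExt a)) (iteratedDeriv (n + 1) (flatExt a) z) z := by
  rw [iteratedDeriv_succ, iteratedDeriv_eq_iterate]
  exact ((analyticAt_flatExt a hz).iterated_deriv n).differentiableAt.hasDerivAt

/-- Near `1` the power `w^{-a}` has real part at least `1/2`. -/
lemma exists_half_le_re_cpow (a : ℝ) :
    ∃ c : ℝ, 0 < c ∧ c < 1 ∧ ∀ w : ℂ, ‖w - 1‖ ≤ c → 1 / 2 ≤ (w ^ (-(a : ℂ))).re := by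
  have hc : ContinuousAt (fun w : ℂ => (w ^ (-(a : ℂ))).re) 1 :=
    Complex.continuous_re.continuousAt.comp
      (continuousAt_id.cpow continuousAt_const Complex.one_mem_slitPlane)
  have h1 : ∀ᶠ w in 𝓝 (1 : ℂ), 1 / 2 < (w ^ (-(a : ℂ))).re :=
    hc.eventually (lt_mem_nhds (by norm_num [Complex.one_cpow]))
  obtain ⟨r, hr, hball⟩ := Metric.eventually_nhds_iff.1 h1
  refine ⟨min (r / 2) (1 / 2), by positivity, (min_le_right _ _).trans_lt (by norm_num),
    fun w hw => (hball ?_).le⟩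
  rw [dist_eq_norm]
  exact (hw.trans (min_le_left _ _)).trans_lt (by linarith)

/-- Scaling: with `z = t w` and `t > 0`, `z^(-a) = t^(-a) w^(-a)`, so the estimate near `1`
transfers to the disc of radius `ct` about `t`. -/
lemma norm_flatExt_le {a c t : ℝ} (ht : 0 < t)
    (hc : ∀ w : ℂ, ‖w - 1‖ ≤ c → 1 / 2 ≤ (w ^ (-(a : ℂ))).re) (hc1 : c < 1) {z : ℂ}
    (hz : ‖z - t‖ ≤ c * t) : ‖flatExt a z‖ ≤ Real.exp (-(t ^ (-a) / 2)) := by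
  have ht' : (t : ℂ) ≠ 0 := by exact_mod_cast ht.ne'
  set w : ℂ := z / t with hw
  have hzw : z = t * w := by rw [hw]; field_simp
  have hw1 : ‖w - 1‖ ≤ c := by
    have : w - 1 = (z - t) / t := by rw [hw]; field_simp
    rw [this, norm_div, Complex.norm_real, Real.norm_of_nonneg ht.le, div_le_iff₀ ht]
    exact hz
  have hw0 : w ≠ 0 := by
    rintro h
    rw [h, zero_sub, norm_neg, norm_one] at hw1
    linarith
  have hpow : z ^ (-(a : ℂ)) = ((t ^ (-a) : ℝ) : ℂ) * w ^ (-(a : ℂ)) := by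
    rw [hzw, Complex.cpow_def_of_ne_zero (mul_ne_zero ht' hw0), Complex.log_ofReal_mul ht hw0,
      add_mul, Complex.exp_add, ← Complex.cpow_def_of_ne_zero hw0, Complex.ofReal_log ht.le,
      ← Complex.cpow_def_of_ne_zero ht', Complex.ofReal_cpow ht.le, Complex.ofReal_neg]
  rw [flatExt, Complex.norm_exp, hpow, Complex.neg_re, Complex.re_ofReal_mul]
  apply Real.exp_le_exp.2
  have := mul_le_mul_of_nonneg_left (hc w hw1) (Real.rpow_pos_of_pos ht (-a)).le
  linarith

/-- After raising to the power `a` and setting `v = t^(-a)`, this is `x^n / n! ≤ e^x` at `x = a v /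
2`. -/
lemma inv_pow_mul_exp_le {a t : ℝ} (ha : 0 < a) (ht : 0 < t) (n : ℕ) :
    (t ^ n)⁻¹ * Real.exp (-(t ^ (-a) / 2)) ≤ ((2 / a) ^ n * n !) ^ a⁻¹ := by
  rw [Real.le_rpow_inv_iff_of_pos (by positivity) (by positivity) ha,
    Real.mul_rpow (by positivity) (by positivity), ← Real.exp_mul]
  have h1 : ((t ^ n)⁻¹) ^ a = (t ^ (-a)) ^ n := by
    rw [Real.inv_rpow (by positivity), ← Real.rpow_natCast, ← Real.rpow_natCast,
      ← Real.rpow_mul ht.le, ← Real.rpow_mul ht.le, ← Real.rpow_neg ht.le]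
    ring_nf
  rw [h1]
  set v := t ^ (-a) with hv
  have hv0 : 0 < v := Real.rpow_pos_of_pos ht _
  have h2 := Real.pow_div_factorial_le_exp (x := v / 2 * a) (by positivity) n
  rw [div_le_iff₀ (by positivity)] at h2
  rw [neg_mul, Real.exp_neg, ← div_eq_mul_inv, div_le_iff₀ (Real.exp_pos _)]
  calc v ^ n = (2 / a) ^ n * (v / 2 * a) ^ n := by
        rw [← mul_pow]; congr 1; field_simp
    _ ≤ (2 / a) ^ n * (Real.exp (v / 2 * a) * n !) := by gcongr
    _ = _ := by ring

/-- Cauchy's estimate on the disc of radius `ct` about `t`, which stays in the slit plane because `c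
< 1`. -/
lemma exists_flatDeriv_bound (a : ℝ) : ∃ c : ℝ, 0 < c ∧ ∀ (n : ℕ) (t : ℝ), 0 < t →
    |flatDeriv a n t| ≤ n ! * (c⁻¹ ^ n * ((t ^ n)⁻¹ * Real.exp (-(t ^ (-a) / 2)))) := by
  obtain ⟨c, hc0, hc1, hc⟩ := exists_half_le_re_cpow a
  refine ⟨c, hc0, fun n t ht => ?_⟩
  rw [flatDeriv, if_pos ht]
  refine (Complex.abs_re_le_norm _).trans ?_
  have hslit : ∀ z ∈ Metric.closedBall (t : ℂ) (c * t), z ∈ Complex.slitPlane := by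
    intro z hz
    rw [Metric.mem_closedBall, dist_eq_norm] at hz
    left
    have h1 := (abs_le.1 ((Complex.abs_re_le_norm _).trans hz)).1
    rw [Complex.sub_re, Complex.ofReal_re] at h1
    nlinarith
  have hd : DiffContOnCl ℂ (flatExt a) (Metric.ball (t : ℂ) (c * t)) := by
    apply DifferentiableOn.diffContOnCl
    rw [closure_ball _ (by positivity)]
    exact fun z hz => (differentiableAt_flatExt a (hslit z hz)).differentiableWithinAt
  refine (Complex.norm_iteratedDeriv_le_of_forall_mem_sphere_norm_le n (by positivity) hd
    fun z hz => norm_flatExt_le ht hc hc1 (by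
      rw [mem_sphere_iff_norm] at hz; exact hz.le)).trans_eq ?_
  rw [mul_pow, inv_pow]
  field_simp

lemma hasDerivAt_flatDeriv {a : ℝ} (ha : 0 < a) (n : ℕ) (t : ℝ) :
    HasDerivAt (flatDeriv a n) (flatDeriv a (n + 1) t) t := by
  rcases lt_trichotomy t 0 with ht | rfl | ht
  · have h1 : flatDeriv a n =ᶠ[𝓝 t] fun _ => 0 := by
      filter_upwards [Iio_mem_nhds ht] with x hx
      exact if_neg (not_lt.2 (le_of_lt hx))
    rw [flatDeriv, if_neg (not_lt.2 ht.le)]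
    exact (hasDerivAt_const t (0 : ℝ)).congr_of_eventuallyEq h1
  · obtain ⟨c, hc, hb⟩ := exists_flatDeriv_bound a
    -- Using the decay with exponent `n + 2` instead of `n` leaves a factor `x²`, which is `o(x)`
    -- and gives derivative `0` at the origin.
    set C := (n ! : ℝ) * (c⁻¹ ^ n * ((2 / a) ^ (n + 2) * ((n + 2)! : ℕ)) ^ a⁻¹) with hC
    have hle : ∀ x, ‖flatDeriv a n x‖ ≤ C * ‖x ^ 2‖ := by
      intro x
      by_cases hx : 0 < x
      · refine (hb n x hx).trans ?_
        have h1 := inv_pow_mul_exp_le ha hx (n + 2)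
        have h2 : (x ^ n)⁻¹ * Real.exp (-(x ^ (-a) / 2)) =
            (x ^ (n + 2))⁻¹ * Real.exp (-(x ^ (-a) / 2)) * x ^ 2 := by
          field_simp
          ring
        rw [h2, Real.norm_of_nonneg (by positivity), hC]
        calc _ ≤ (n ! : ℝ) * (c⁻¹ ^ n * (((2 / a) ^ (n + 2) * ((n + 2)! : ℕ)) ^ a⁻¹ * x ^ 2)) := by
              gcongr
          _ = _ := by ring
      · rw [flatDeriv, if_neg hx, norm_zero]
        positivity
    have h0 : ∀ k, flatDeriv a k 0 = 0 := fun k => if_neg (lt_irrefl _)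
    rw [h0, hasDerivAt_iff_isLittleO]
    simp only [h0, sub_zero, smul_zero]
    refine (Asymptotics.IsBigO.of_bound C (Eventually.of_forall hle)).trans_isLittleO ?_
    exact Asymptotics.isLittleO_pow_id one_lt_two
  · have h1 := (hasDerivAt_iteratedDeriv_flatExt a n
      (Complex.ofReal_mem_slitPlane.2 ht)).real_of_complex
    rw [flatDeriv, if_pos ht]
    refine h1.congr_of_eventuallyEq ?_
    filter_upwards [Ioi_mem_nhds ht] with x hx
    exact if_pos hx

lemma iteratedDeriv_eq_of_hasDerivAt {g : ℕ → ℝ → ℝ}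
    (hg : ∀ n t, HasDerivAt (g n) (g (n + 1) t) t) (n : ℕ) : iteratedDeriv n (g 0) = g n := by
  induction n with
  | zero => exact iteratedDeriv_zero
  | succ n ih => rw [iteratedDeriv_succ, ih]; exact funext fun t => (hg n t).deriv

lemma contDiff_of_hasDerivAt {g : ℕ → ℝ → ℝ} (hg : ∀ n t, HasDerivAt (g n) (g (n + 1) t) t) :
    ContDiff ℝ ∞ (g 0) := by
  refine contDiff_of_differentiable_iteratedDeriv fun n _ => ?_
  rw [iteratedDeriv_eq_of_hasDerivAt hg]
  exact fun t => (hg n t).differentiableAt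

lemma flatPhase_eq (s : ℝ) : flatPhase s = flatDeriv (1 / (s - 1)) 0 := by
  ext t
  rw [flatDeriv_zero, flatPhase]

/-- One factor `n!` comes from Cauchy's estimate, the other `(n!)^(s-1)` from the exponential decay,
as `1/a = s - 1`. -/
lemma gevrey_flatPhase {s : ℝ} (hs : 1 < s) : Gevrey s (flatPhase s) := by
  have ha : 0 < 1 / (s - 1) := one_div_pos.2 (by linarith)
  have hinv : (1 / (s - 1))⁻¹ = s - 1 := by rw [one_div, inv_inv]
  rw [flatPhase_eq]
  set a := 1 / (s - 1) with hadef
  have hcd : ContDiff ℝ ∞ (flatDeriv a 0) := contDiff_of_hasDerivAt (hasDerivAt_flatDeriv ha)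
  obtain ⟨c, hc, hb⟩ := exists_flatDeriv_bound a
  refine ⟨hcd.contDiffOn, max (c⁻¹ * (2 / a) ^ (s - 1)) 1, by positivity, fun n t ht => ?_⟩
  rw [iteratedDerivWithin_eq_iteratedDeriv (uniqueDiffOn_Icc (by norm_num))
    (hcd.of_le (by exact_mod_cast le_top)).contDiffAt ht,
    iteratedDeriv_eq_of_hasDerivAt (hasDerivAt_flatDeriv ha)]
  by_cases ht0 : 0 < t
  · refine (hb n t ht0).trans ?_
    have h1 := inv_pow_mul_exp_le ha ht0 n
    rw [hinv, Real.mul_rpow (by positivity) (by positivity)] at h1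
    have h2 : ((2 / a) ^ n) ^ (s - 1) = ((2 / a) ^ (s - 1)) ^ n := by
      rw [← Real.rpow_natCast, ← Real.rpow_natCast, ← Real.rpow_mul (by positivity),
        ← Real.rpow_mul (by positivity), mul_comm]
    have hfac : (0 : ℝ) < n ! := by positivity
    have h3 : (n ! : ℝ) ^ s = n ! * (n ! : ℝ) ^ (s - 1) := by
      rw [← Real.rpow_one_add' hfac.le (by linarith)]; congr 1; ring
    calc (n ! : ℝ) * (c⁻¹ ^ n * ((t ^ n)⁻¹ * Real.exp (-(t ^ (-a) / 2))))
        ≤ n ! * (c⁻¹ ^ n * (((2 / a) ^ n) ^ (s - 1) * (n ! : ℝ) ^ (s - 1))) := by gcongr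
      _ = (c⁻¹ * (2 / a) ^ (s - 1)) ^ n * (n ! : ℝ) ^ s := by rw [h2, h3, mul_pow]; ring
      _ ≤ (max (c⁻¹ * (2 / a) ^ (s - 1)) 1) ^ n * (n ! : ℝ) ^ s := by
        gcongr
        exact le_max_left _ _
      _ ≤ _ := by
        gcongr
        · exact le_max_right _ _
        · omega
  · rw [flatDeriv, if_neg ht0, abs_zero]
    positivity

/-! ### The lower bound for the flat phase. -/

/-- Away from the origin the flat phase oscillates enough to make the integral negligible. -/
lemma norm_oscInt_flat_le {a lam δ : ℝ} (ha : 0 < a) (hlam : 0 < lam) (hδ : 0 < δ) (hδ1 : δ ≤ 1) :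
    ‖oscInt (fun t => Real.exp (-(t ^ (-a)))) lam δ 1‖ ≤
      2 * (δ ^ a * Real.exp (δ ^ (-a)) / (a * lam)) := by
  have hpos : ∀ t ∈ Icc δ 1, 0 < t := fun t ht => hδ.trans_le ht.1
  have hrpow : ∀ p : ℝ, ContinuousOn (fun t : ℝ => t ^ p) (Icc δ 1) := fun p t ht =>
    (Real.continuousAt_rpow_const t p (Or.inl (hpos t ht).ne')).continuousWithinAt
  have hderiv : ∀ (p : ℝ), ∀ t ∈ Ioo δ 1, HasDerivAt (fun t : ℝ => t ^ p) (p * t ^ (p - 1)) t :=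
    fun p t ht => Real.hasDerivAt_rpow_const (Or.inl (hδ.trans ht.1).ne')
  -- This is `1/(λ t f')`. It decreases on `(0,1]`, so it can serve as its own `W`, and the three
  -- terms add up to `2 G(δ)`.
  set G : ℝ → ℝ := fun t => t ^ a * Real.exp (t ^ (-a)) / (a * lam) with hG
  set G' : ℝ → ℝ := fun t => (a * t ^ (a - 1) * Real.exp (t ^ (-a)) +
    t ^ a * (Real.exp (t ^ (-a)) * (-a * t ^ (-a - 1)))) / (a * lam) with hG'
  have hGc : ContinuousOn G (Icc δ 1) := by
    exact ((hrpow a).mul (Real.continuous_exp.comp_continuousOn (hrpow (-a)))).div_const _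
  have hG'c : ContinuousOn G' (Icc δ 1) :=
    (((continuousOn_const.mul (hrpow (a - 1))).mul
      (Real.continuous_exp.comp_continuousOn (hrpow (-a)))).add
      ((hrpow a).mul ((Real.continuous_exp.comp_continuousOn (hrpow (-a))).mul
        (continuousOn_const.mul (hrpow (-a - 1)))))).div_const _
  have hGd : ∀ t ∈ Ioo δ 1, HasDerivAt G (G' t) t := fun t ht =>
    ((hderiv a t ht).mul (hderiv (-a) t ht).exp).div_const _
  have hG'neg : ∀ t ∈ Icc δ 1, G' t ≤ 0 := by
    intro t ht
    have htp := hpos t ht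
    apply div_nonpos_of_nonpos_of_nonneg _ (by positivity)
    have h1 : t ^ a * t ^ (-a - 1) = t⁻¹ := by
      rw [← Real.rpow_add htp, ← Real.rpow_neg_one]; congr 1; ring
    have h2 : t ^ (a - 1) ≤ t⁻¹ := by
      rw [← Real.rpow_neg_one]
      exact Real.rpow_le_rpow_of_exponent_ge htp ht.2 (by linarith)
    have h3 : a * t ^ (a - 1) * Real.exp (t ^ (-a)) +
        t ^ a * (Real.exp (t ^ (-a)) * (-a * t ^ (-a - 1))) =
        a * Real.exp (t ^ (-a)) * (t ^ (a - 1) - t ^ a * t ^ (-a - 1)) := by ring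
    rw [h3, h1]
    exact mul_nonpos_of_nonneg_of_nonpos (by positivity) (by linarith)
  have hGpos : ∀ t, 0 < t → 0 ≤ G t := fun t ht => by
    have := ht
    simp only [hG]
    positivity
  have key := norm_oscInt_le_of_deriv (f := fun t => Real.exp (-(t ^ (-a))))
    (f' := fun t => Real.exp (-(t ^ (-a))) * -(-a * t ^ (-a - 1))) (G := G) (G' := G') (W := G)
    (W' := G') (lam := lam) hδ hδ1
    (Real.continuous_exp.comp_continuousOn (hrpow (-a)).neg)
    (fun t ht => (hderiv (-a) t ht).fun_neg.exp) hGc hGd hG'c hGc hGd hG'c ?_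
    (fun t ht => (abs_of_nonpos (hG'neg t ht)).le)
  · rw [abs_of_nonneg (hGpos δ hδ), abs_of_nonneg (hGpos 1 one_pos)] at key
    linarith
  · intro t ht
    have htp := hδ.trans ht.1
    have h1 : t * t ^ (-a - 1) * t ^ a = 1 := by
      nth_rewrite 1 [← Real.rpow_one t]
      rw [← Real.rpow_add htp, ← Real.rpow_add htp]
      ring_nf
      exact Real.rpow_zero t
    have h2 : Real.exp (-(t ^ (-a))) * Real.exp (t ^ (-a)) = 1 := by
      rw [← Real.exp_add, neg_add_cancel, Real.exp_zero]
    simp only [hG]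
    calc _ = (a * lam) * (t * t ^ (-a - 1) * t ^ a) *
          (Real.exp (-(t ^ (-a))) * Real.exp (t ^ (-a))) / (a * lam) := by ring
      _ = 1 := by rw [h1, h2]; field_simp

lemma oscInt_zero (lam : ℝ) {ε : ℝ} (hε : 0 < ε) :
    oscInt (fun _ => 0) lam ε 1 = (Real.log (1 / ε) : ℂ) := by
  rw [← integral_one_div_of_pos hε one_pos, oscInt, ← intervalIntegral.integral_ofReal]
  simp

/-- The left side contributes `log(1/ε)`, and the right side cancels at most `log(δ/ε)` of it below
`δ`; the difference no longer depends on `ε`. -/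
lemma log_sub_norm_oscInt_le_norm_truncated {ψ : ℝ → ℝ} (hψ : ContinuousOn ψ (Icc 0 1))
    (hneg : ∀ t < 0, ψ t = 0) (lam : ℝ) {ε δ : ℝ} (hε : 0 < ε) (hεδ : ε ≤ δ) (hδ : δ ≤ 1) :
    Real.log (1 / δ) - ‖oscInt ψ lam δ 1‖ ≤ ‖truncated ψ lam ε‖ := by
  have hδ0 : 0 < δ := hε.trans_le hεδ
  have h0 : oscInt (fun t => ψ (-t)) lam ε 1 = (Real.log (1 / ε) : ℂ) := by
    rw [← oscInt_zero lam hε]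
    refine intervalIntegral.integral_congr fun t ht => ?_
    rw [uIcc_of_le (hεδ.trans hδ)] at ht
    simp only [hneg (-t) (by linarith [ht.1])]
  have h1 : Real.log (1 / ε) ≤ ‖oscInt ψ lam ε 1‖ + ‖truncated ψ lam ε‖ := by
    have : (Real.log (1 / ε) : ℂ) = oscInt ψ lam ε 1 - truncated ψ lam ε := by
      rw [truncated_eq, h0]; ring
    calc Real.log (1 / ε) ≤ ‖(Real.log (1 / ε) : ℂ)‖ := by
          rw [Complex.norm_real]; exact le_abs_self _
      _ ≤ _ := by rw [this]; exact norm_sub_le _ _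
  have h2 : ‖oscInt ψ lam ε 1‖ ≤ Real.log (δ / ε) + ‖oscInt ψ lam δ 1‖ := by
    rw [← oscInt_add hψ lam hε hεδ hδ le_rfl]
    exact (norm_add_le _ _).trans (add_le_add (norm_oscInt_le_log ψ lam hε hεδ) le_rfl)
  have h3 : Real.log (1 / ε) = Real.log (1 / δ) + Real.log (δ / ε) := by
    rw [← Real.log_mul (by positivity) (by positivity)]
    congr 1
    field_simp
  linarith

lemma le_norm_m_flatPhase {s lam : ℝ} (hs : 1 < s) (hlam : Real.exp 1 ≤ lam) :
    (s - 1) * (Real.log (Real.log lam) - 2) ≤ ‖m (flatPhase s) lam‖ := by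
  have ha : 0 < 1 / (s - 1) := one_div_pos.2 (by linarith)
  have hcd := (gevrey_flatPhase hs).1
  have hlam0 : 0 < lam := (Real.exp_pos 1).trans_le hlam
  have hL : 1 ≤ Real.log lam := by rwa [Real.le_log_iff_exp_le hlam0]
  have hL0 : 0 < Real.log lam := by linarith
  -- The point where `λψ(δ) = 1`.
  set δ := Real.log lam ^ (-(s - 1)) with hδ
  have hδ0 : 0 < δ := Real.rpow_pos_of_pos hL0 _
  have hδ1 : δ ≤ 1 := Real.rpow_le_one_of_one_le_of_nonpos hL (by linarith)
  have hosc : ‖oscInt (flatPhase s) lam δ 1‖ ≤ 2 * (s - 1) := by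
    have h1 : oscInt (flatPhase s) lam δ 1 =
        oscInt (fun t => Real.exp (-(t ^ (-(1 / (s - 1)))))) lam δ 1 := by
      refine intervalIntegral.integral_congr fun t ht => ?_
      rw [uIcc_of_le hδ1] at ht
      simp only [flatPhase, if_pos (hδ0.trans_le ht.1)]
    rw [h1]
    refine (norm_oscInt_flat_le ha hlam0 hδ0 hδ1).trans ?_
    have hs0 : s - 1 ≠ 0 := by linarith
    have h2 : δ ^ (-(1 / (s - 1))) = Real.log lam := by
      rw [hδ, ← Real.rpow_mul hL0.le, show -(s - 1) * -(1 / (s - 1)) = 1 by field_simp,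
        Real.rpow_one]
    have h3 : δ ^ (1 / (s - 1)) ≤ 1 := Real.rpow_le_one hδ0.le hδ1 ha.le
    rw [h2, Real.exp_log hlam0]
    have h4 : δ ^ (1 / (s - 1)) * lam / (1 / (s - 1) * lam) = δ ^ (1 / (s - 1)) * (s - 1) := by
      field_simp
    rw [h4]
    nlinarith
  have hlog : Real.log (1 / δ) = (s - 1) * Real.log (Real.log lam) := by
    rw [one_div, Real.log_inv, hδ, Real.log_rpow hL0]; ring
  refine ge_of_tendsto (tendsto_truncated_m hcd lam).norm ?_
  filter_upwards [Ioc_mem_nhdsGT hδ0] with ε hε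
  have := log_sub_norm_oscInt_le_norm_truncated (continuousOn_pos hcd)
    (fun t ht => if_neg (not_lt.2 ht.le)) lam hε.1 hε.2 hδ1
  rw [hlog] at this
  linarith

lemma isBigO_log_log_m_flatPhase {s : ℝ} (hs : 1 < s) :
    (fun lam : ℝ => Real.log (Real.log lam)) =O[atTop] m (flatPhase s) := by
  refine Asymptotics.IsBigO.of_bound (2 / (s - 1)) ?_
  -- Once `log log λ ≥ 4`, subtracting `2` loses at most half of it, whence the constant `2/(s-1)`.
  filter_upwards [eventually_ge_atTop (Real.exp 1), tendsto_log_log.eventually_ge_atTop 4]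
    with lam h1 h2
  have h3 := le_norm_m_flatPhase hs h1
  have hs0 : 0 < s - 1 := by linarith
  rw [Real.norm_of_nonneg (by linarith), div_mul_eq_mul_div, le_div_iff₀ hs0]
  nlinarith

end SteinWainger

theorem theorem1p3 (s : ℝ) (hs : 1 < s) :
    (∀ ψ : ℝ → ℝ, SteinWainger.Gevrey s ψ →
      (∀ lam : ℝ, Filter.Tendsto (SteinWainger.truncated ψ lam)
        (nhdsWithin (0 : ℝ) (Set.Ioi 0)) (nhds (SteinWainger.m ψ lam))) ∧
      Asymptotics.IsBigO Filter.atTop (SteinWainger.m ψ)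
        (fun lam : ℝ => Real.log (Real.log lam))) ∧
    (SteinWainger.Gevrey s (SteinWainger.flatPhase s) ∧
      Asymptotics.IsTheta Filter.atTop
        (fun n : ℕ => SteinWainger.m (SteinWainger.flatPhase s) (2 * Real.pi * (n : ℝ)))
        (fun n : ℕ => Real.log (Real.log (2 * Real.pi * (n : ℝ))))) := by
  have hs0 : 0 ≤ s := by linarith
  have hG := SteinWainger.gevrey_flatPhase hs
  have htend : Filter.Tendsto (fun n : ℕ => 2 * Real.pi * (n : ℝ)) Filter.atTop Filter.atTop :=
    tendsto_natCast_atTop_atTop.const_mul_atTop (by positivity)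
  exact ⟨fun ψ hψ => ⟨SteinWainger.tendsto_truncated_m hψ.1, hψ.isBigO_m hs0⟩, hG,
    (hG.isBigO_m hs0).comp_tendsto htend,
    (SteinWainger.isBigO_log_log_m_flatPhase hs).comp_tendsto htend⟩
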